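/- Let $\ell \ge 1$ and $d\ge 1$ be integers, let $A_1,\dots,A_\ell$ be complex $d\times d$ matrices, and write $\Sigma_\ell=\{1,\dots,\ell\}^{\mathbb N}$ for the space of one-sided sequences $x=(x_1,x_2,\dots)$, with the product topology and its Borel $\sigma$-algebra. For $x\in\Sigma_\ell$ and $n \ge 1$ put $\mathcal L(x,n)=A_{x_n}A_{x_{n-1}}\cdots A_{x_1}$. A full Markov measure is a Borel probability measure $\mu$ on $\Sigma_\ell$ for which there are a probability vector $p=(p_1,\dots,p_\ell)$ and a row-stochastic matrix $P=(P_{ij})_{i,j=1}^{\ell}$ with $pP=p$ and $P_{ij}\neq 0$ for all $i,j$, such that for every $n\ge 1$ and every word $w_1\cdots w_n$ over $\{1,\dots,\ell\}$ $$\mu\bigl(\{x\in\Sigma_\ell : x_1=w_1,\dots,x_n=w_n\}\bigr)=p_{w_1}P_{w_1w_2}\cdots P_{w_{n-1}w_n}.$$ Suppose that the discrete linear inclusion associated to $\{A_1,\dots,A_\ell\}$ is periodically asymptotically stable, that is, $\mathcal L(x,n)v_0\to 0$ as $n\to\infty$ for every $v_0\in\mathbb C^d$ and every $x \in\Sigma_\ell$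 that is periodic (there is $q\ge 1$ with $x_{i+q}=x_i$ for all $i\ge 1$). Then it is Markov asymptotically stable: for every full Markov measure $\mu$ on $\Sigma_\ell$, for $\mu$-almost every $x\in\Sigma_\ell$ we have $\mathcal L(x,n)v_0\to 0$ as $n\to\infty$ for every $v_0\in\mathbb C^d$. -/

import Mathlib

open MeasureTheory Filter Topology
open scoped Matrix

/-- The space of one-sided infinite sequences over an alphabet with `l` symbols.  It carries the
product topology, and the product `σ`-algebra, which is its Borel `σ`-algebra.  Sequences are
indexed from `0`. -/
abbrev SymbolSeq (l : ℕ) : Type := ℕ → Fin l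

/-- The shift transformation on sequences. -/
def shift {l : ℕ} (x : SymbolSeq l) : SymbolSeq l := fun n => x (n + 1)

/-- The cocycle `A_{x_{n-1}} ⋯ A_{x_1} A_{x_0}` (later factors multiply on the left). -/
def cocycle {l d : ℕ} (A : Fin l → Matrix (Fin d) (Fin d) ℂ) (x : SymbolSeq l) :
    ℕ → Matrix (Fin d) (Fin d) ℂ
  | 0 => 1
  | n + 1 => A (x n) * cocycle A x n

/-- The trajectory `v_n = A_{x_{n-1}} ⋯ A_{x_0} v₀` of the discrete linear inclusion of `A`
with switching sequence `x` and initial vector `v₀`. -/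
def trajectory {l d : ℕ} (A : Fin l → Matrix (Fin d) (Fin d) ℂ) (x : SymbolSeq l)
    (v₀ : Fin d → ℂ) (n : ℕ) : Fin d → ℂ :=
  cocycle A x n *ᵥ v₀

/-- Every trajectory whose switching sequence is periodic under the shift converges to `0`. -/
def IsPeriodicallyAsymptoticallyStable {l d : ℕ} (A : Fin l → Matrix (Fin d) (Fin d) ℂ) : Prop :=
  ∀ x ∈ Function.periodicPts (shift (l := l)), ∀ v₀ : Fin d → ℂ,
    Tendsto (trajectory A x v₀) atTop (𝓝 0)

/-- `μ` is the (stationary) Markov measure with initial probability vector `p` and transition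
matrix `P`: `P` is row-stochastic, `p P = p`, and `μ` is the probability measure giving the
cylinder of the word `w₀ w₁ … wₙ` the mass `p_{w₀} P_{w₀ w₁} ⋯ P_{w_{n-1} w_n}`. -/
structure IsMarkovMeasureWith {l : ℕ} (μ : Measure (SymbolSeq l)) (p : Fin l → ℝ)
    (P : Matrix (Fin l) (Fin l) ℝ) : Prop where
  isProbabilityMeasure : IsProbabilityMeasure μ
  initial_mem : p ∈ stdSimplex ℝ (Fin l)
  transition_mem : P ∈ Matrix.rowStochastic ℝ (Fin l)
  stationary : p ᵥ* P = p
  cylinder : ∀ (n : ℕ) (w : Fin (n + 1) → Fin l),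
    μ {x | ∀ k : Fin (n + 1), x k = w k} =
      ENNReal.ofReal (p (w 0) * ∏ k : Fin n, P (w k.castSucc) (w k.succ))

/-- A full Markov measure: a Markov measure all of whose transition probabilities are nonzero. -/
def IsFullMarkovMeasure {l : ℕ} (μ : Measure (SymbolSeq l)) : Prop :=
  ∃ (p : Fin l → ℝ) (P : Matrix (Fin l) (Fin l) ℝ),
    IsMarkovMeasureWith μ p P ∧ ∀ i j, P i j ≠ 0

/-- For every full Markov measure, almost every switching sequence makes all of its trajectories
converge to `0`. -/
def IsMarkovAsymptoticallyStable {l d : ℕ} (A : Fin l → Matrix (Fin d) (Fin d) ℂ) : Prop :=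
  ∀ μ : Measure (SymbolSeq l), IsFullMarkovMeasure μ →
    ∀ᵐ x ∂μ, ∀ v₀ : Fin d → ℂ, Tendsto (trajectory A x v₀) atTop (𝓝 0)

/-! ### Word products: stability, traces, and Burnside's theorem -/

section LinearAlgebra

variable {ι V W : Type*} [AddCommGroup V] [Module ℂ V] [AddCommGroup W] [Module ℂ W]

/-! The key is a norm `F` on `ℂ^d` and a `c < 1` such that one random step multiplies the mean of
`F` by at most `c`, whatever the law of the next letter, provided each letter has probability at
least `p = min P i j > 0`. Expectations of `F` along a trajectory then decay geometrically, hence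
are summable, and `F` tends to `0` almost surely.

`IsWeaklyPeriodicallyStable.exists_isLyapunovNorm` builds `F` by induction on dimension. For an
irreducible family, periodic stability puts the eigenvalues of nonempty products in the open unit
disc, so traces of products are bounded. By Burnside's theorem word products span all endomorphisms,
so matrix coefficients are bounded too, and a supremum over words gives a nonexpansive norm. A
weighted sum along the powers of one letter makes it contract on average. For a reducible family,
norms on an invariant subspace and its quotient are glued, with a large weight on the quotient. -/

/-- The product of the endomorphisms `T i` along the letters of a word. -/
def wordProd (T : ι → Module.End ℂ V) (w : List ι) : Module.End ℂ V := (w.map T).prod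

@[simp] lemma wordProd_nil (T : ι → Module.End ℂ V) : wordProd T [] = 1 := rfl

@[simp] lemma wordProd_cons (T : ι → Module.End ℂ V) (i : ι) (w : List ι) :
    wordProd T (i :: w) = T i * wordProd T w := by simp [wordProd]

lemma wordProd_append (T : ι → Module.End ℂ V) (u w : List ι) :
    wordProd T (u ++ w) = wordProd T u * wordProd T w := by simp [wordProd]

/-- All powers of products along nonempty words converge weakly to `0`. -/
def IsWeaklyPeriodicallyStable (T : ι → Module.End ℂ V) : Prop :=
  ∀ w : List ι, w ≠ [] → ∀ (φ : Module.Dual ℂ V) (v : V),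
    Tendsto (fun k : ℕ => φ ((wordProd T w ^ k) v)) atTop (𝓝 0)

lemma wordProd_intertwine {T : ι → Module.End ℂ V} {S : ι → Module.End ℂ W} (f : V →ₗ[ℂ] W)
    (h : ∀ i v, f (T i v) = S i (f v)) (w : List ι) (v : V) :
    f (wordProd T w v) = wordProd S w (f v) := by
  induction w with
  | nil => rfl
  | cons i w ih => simp [h, ih]

lemma pow_intertwine {T : Module.End ℂ V} {S : Module.End ℂ W} (f : V →ₗ[ℂ] W)
    (h : ∀ v, f (T v) = S (f v)) (k : ℕ) (v : V) : f ((T ^ k) v) = (S ^ k) (f v) := by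
  induction k with
  | zero => rfl
  | succ k ih => simp [pow_succ', h, ih]

lemma IsWeaklyPeriodicallyStable.of_surjective {T : ι → Module.End ℂ V}
    {S : ι → Module.End ℂ W} (hT : IsWeaklyPeriodicallyStable T) (f : V →ₗ[ℂ] W)
    (hf : Function.Surjective f) (h : ∀ i v, f (T i v) = S i (f v)) :
    IsWeaklyPeriodicallyStable S := by
  intro w hw φ v
  obtain ⟨u, rfl⟩ := hf v
  refine (hT w hw (φ ∘ₗ f) u).congr fun k => ?_
  simp [pow_intertwine f (wordProd_intertwine f h w)]

lemma IsWeaklyPeriodicallyStable.of_injective {T : ι → Module.End ℂ V}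
    {S : ι → Module.End ℂ W} (hT : IsWeaklyPeriodicallyStable T) (f : W →ₗ[ℂ] V)
    (hf : Function.Injective f) (h : ∀ i v, f (S i v) = T i (f v)) :
    IsWeaklyPeriodicallyStable S := by
  intro w hw φ v
  obtain ⟨g, hg⟩ := f.exists_leftInverse_of_injective (LinearMap.ker_eq_bot.2 hf)
  refine (hT w hw (φ ∘ₗ g) (f v)).congr fun k => ?_
  rw [← pow_intertwine f (wordProd_intertwine f h w), LinearMap.comp_apply,
    ← LinearMap.comp_apply g f, hg, LinearMap.id_apply]

lemma norm_lt_one_of_hasEigenvalue {S : Module.End ℂ V}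
    (h : ∀ (φ : Module.Dual ℂ V) (v : V), Tendsto (fun k : ℕ => φ ((S ^ k) v)) atTop (𝓝 0))
    {r : ℂ} (hr : S.HasEigenvalue r) : ‖r‖ < 1 := by
  obtain ⟨v, hv⟩ := hr.exists_hasEigenvector
  obtain ⟨φ, hφ⟩ := Module.Projective.exists_dual_ne_zero ℂ hv.2
  have h1 := (h φ v).div_const (φ v)
  have : Tendsto (fun k : ℕ => r ^ k) atTop (𝓝 0) := by
    simpa [hv.pow_apply, hφ] using h1
  exact tendsto_pow_atTop_nhds_zero_iff_norm_lt_one.1 this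

lemma norm_trace_le_finrank [FiniteDimensional ℂ V] {S : Module.End ℂ V}
    (h : ∀ r : ℂ, S.HasEigenvalue r → ‖r‖ ≤ 1) :
    ‖LinearMap.trace ℂ V S‖ ≤ Module.finrank ℂ V := by
  rw [Module.End.trace_eq_sum_roots_charpoly_of_splits (IsAlgClosed.splits _)]
  have h1 : ∀ s : Multiset ℂ, (∀ r ∈ s, ‖r‖ ≤ 1) → ‖s.sum‖ ≤ s.card := by
    intro s
    induction s using Multiset.induction_on with
    | empty => simp
    | cons a s ih =>
      intro hs
      have := ih fun r hr => hs r (Multiset.mem_cons_of_mem hr)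
      have := hs a (Multiset.mem_cons_self _ _)
      have := norm_add_le a s.sum
      simp only [Multiset.sum_cons, Multiset.card_cons, Nat.cast_add, Nat.cast_one]
      linarith
  refine (h1 _ fun r hr => h r ?_).trans ?_
  · exact Module.End.hasEigenvalue_iff_isRoot_charpoly _ _ |>.2 (Polynomial.isRoot_of_mem_roots hr)
  · rw [← LinearMap.charpoly_natDegree S]
    exact_mod_cast Polynomial.card_roots' _

lemma IsWeaklyPeriodicallyStable.norm_trace_le [FiniteDimensional ℂ V]
    {T : ι → Module.End ℂ V} (hT : IsWeaklyPeriodicallyStable T) (w : List ι) :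
    ‖LinearMap.trace ℂ V (wordProd T w)‖ ≤ Module.finrank ℂ V := by
  rcases eq_or_ne w [] with rfl | hw
  · simp
  · exact norm_trace_le_finrank fun r hr => (norm_lt_one_of_hasEigenvalue (hT w hw) hr).le

/-- The only common invariant subspaces of the endomorphisms `T i` are the trivial ones. -/
def IsIrreducibleFamily (T : ι → Module.End ℂ V) : Prop :=
  ∀ U : Submodule ℂ V, (∀ i, U ≤ U.comap (T i)) → U = ⊥ ∨ U = ⊤

/-- Burnside's theorem on matrix algebras. -/
lemma IsIrreducibleFamily.adjoin_eq_top [FiniteDimensional ℂ V] [Nontrivial V]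
    {T : ι → Module.End ℂ V} (hT : IsIrreducibleFamily T) :
    Algebra.adjoin ℂ (Set.range T) = ⊤ := by
  set R := Algebra.adjoin ℂ (Set.range T)
  have hmem : ∀ i, T i ∈ R := fun i => Algebra.subset_adjoin ⟨i, rfl⟩
  have : IsSimpleModule R V := by
    refine (isSimpleModule_iff R V).2 { eq_bot_or_eq_top := fun U => ?_ }
    refine (hT (U.restrictScalars ℂ) fun i v hv => U.smul_mem ⟨T i, hmem i⟩ hv).imp ?_ ?_ <;>
    · intro h
      simpa using h
  refine eq_top_iff.2 fun S _ => ?_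
  -- Schur's lemma: the commutant consists of scalars, so every `S` is linear over it and the
  -- density theorem applies to a basis.
  have hS : ∀ (g : Module.End R V) (v : V), S (g v) = g (S v) := by
    intro g v
    obtain ⟨c, rfl⟩ := (IsSimpleModule.algebraMap_end_bijective_of_isAlgClosed
      (A := R) (V := V) ℂ).2 g
    simp [Module.algebraMap_end_apply]
  let f : Module.End (Module.End R V) V :=
    { toFun := S, map_add' := S.map_add, map_smul' := hS }
  let b := Module.finBasis ℂ V
  classical
  obtain ⟨r, hr⟩ := jacobson_density f (Finset.univ.image b)
  have : S = r := b.ext fun i => hr (b i) (by simp)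
  rw [this]
  exact r.2

lemma IsIrreducibleFamily.mem_span_wordProd [FiniteDimensional ℂ V] [Nontrivial V]
    {T : ι → Module.End ℂ V} (hT : IsIrreducibleFamily T) (S : Module.End ℂ V) :
    S ∈ Submodule.span ℂ (Set.range (wordProd T)) := by
  have h : S ∈ Subalgebra.toSubmodule (Algebra.adjoin ℂ (Set.range T)) := by
    rw [hT.adjoin_eq_top]; trivial
  rw [Algebra.adjoin_eq_span] at h
  refine Submodule.span_mono (fun x hx => ?_) h
  induction hx using Submonoid.closure_induction with
  | mem x hx =>
    obtain ⟨i, rfl⟩ := hx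
    exact ⟨[i], by simp⟩
  | one => exact ⟨[], rfl⟩
  | mul x y _ _ hx hy =>
    obtain ⟨u, rfl⟩ := hx
    obtain ⟨w, rfl⟩ := hy
    exact ⟨u ++ w, wordProd_append T u w⟩

/-- A coefficient `φ (T_w v)` is the trace of `T_w` times a rank-one map. That map is a finite
combination of word products, and traces of words are bounded by the dimension. -/
lemma IsIrreducibleFamily.exists_norm_apply_wordProd_le [FiniteDimensional ℂ V] [Nontrivial V]
    {T : ι → Module.End ℂ V} (hT : IsIrreducibleFamily T) (hs : IsWeaklyPeriodicallyStable T)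
    (φ : Module.Dual ℂ V) (v : V) : ∃ C : ℝ, ∀ w, ‖φ (wordProd T w v)‖ ≤ C := by
  have key : ∀ S : Module.End ℂ V,
      ∃ C : ℝ, ∀ w, ‖LinearMap.trace ℂ V (wordProd T w * S)‖ ≤ C := by
    intro S
    induction hT.mem_span_wordProd S using Submodule.span_induction with
    | mem S hS =>
      obtain ⟨u, rfl⟩ := hS
      exact ⟨_, fun w => wordProd_append T w u ▸ hs.norm_trace_le (w ++ u)⟩
    | zero => exact ⟨0, by simp⟩
    | add S₁ S₂ _ _ h₁ h₂ =>
      obtain ⟨C₁, h₁⟩ := h₁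
      obtain ⟨C₂, h₂⟩ := h₂
      refine ⟨C₁ + C₂, fun w => ?_⟩
      rw [mul_add, map_add]
      exact norm_add_le_of_le (h₁ w) (h₂ w)
    | smul c S _ h =>
      obtain ⟨C, h⟩ := h
      refine ⟨‖c‖ * C, fun w => ?_⟩
      rw [mul_smul_comm, map_smul, norm_smul]
      exact mul_le_mul_of_nonneg_left (h w) (norm_nonneg c)
  obtain ⟨C, hC⟩ := key (φ.smulRight v)
  refine ⟨C, fun w => ?_⟩
  have : wordProd T w * φ.smulRight v = φ.smulRight (wordProd T w v) := by
    ext; simp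
  simpa [this, LinearMap.trace_smulRight] using hC w

/-- On a finite-dimensional space every seminorm is dominated by every norm. -/
lemma Seminorm.exists_le_mul_of_definite [FiniteDimensional ℂ V] (F G : Seminorm ℂ V)
    (hF : ∀ v, F v = 0 → v = 0) : ∃ C : ℝ, 0 ≤ C ∧ ∀ v, G v ≤ C * F v := by
  -- With `F` as the norm, coordinate functionals have finite operator norms.
  let : Norm V := ⟨F⟩
  have core : NormedSpace.Core ℂ V :=
    { norm_nonneg := fun v => apply_nonneg F v
      norm_smul := fun c v => map_smul_eq_mul F c v
      norm_triangle := fun u v => map_add_le_add F u v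
      norm_eq_zero_iff := fun v => ⟨hF v, fun h => h ▸ map_zero F⟩ }
  let : NormedAddCommGroup V := NormedAddCommGroup.ofCore core
  let : NormedSpace ℂ V := NormedSpace.ofCore core
  let b := Module.finBasis ℂ V
  let ψ : ∀ i, V →L[ℂ] ℂ := fun i => (b.coord i).toContinuousLinearMap
  refine ⟨∑ i, ‖ψ i‖ * G (b i), by positivity, fun v => ?_⟩
  calc G v = G (∑ i, b.repr v i • b i) := by rw [b.sum_repr]
    _ ≤ ∑ i, G (b.repr v i • b i) := Finset.le_sum_of_subadditive G (map_zero G).le (map_add_le_add G) _ _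
    _ = ∑ i, ‖ψ i v‖ * G (b i) := by simp [ψ, map_smul_eq_mul]
    _ ≤ ∑ i, ‖ψ i‖ * F v * G (b i) := by
      gcongr with i
      exact (ψ i).le_opNorm v
    _ = (∑ i, ‖ψ i‖ * G (b i)) * F v := by
      rw [Finset.sum_mul]; exact Finset.sum_congr rfl fun _ _ => by ring

end LinearAlgebra

/-! ### Norms that contract on average -/

section Lyapunov

variable {ι V : Type*} [AddCommGroup V] [Module ℂ V]

/-- `F` is a norm that contracts on average by a factor `c` under the endomorphisms `T i`, for all
probability weights that are bounded below by `p`. -/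
structure IsLyapunovNorm [Fintype ι] (p : ℝ) (T : ι → Module.End ℂ V) (F : Seminorm ℂ V)
    (c : ℝ) : Prop where
  definite : ∀ v, F v = 0 → v = 0
  average_le : ∀ q : ι → ℝ, (∀ i, p ≤ q i) → ∑ i, q i = 1 →
    ∀ v, ∑ i, q i * F (T i v) ≤ c * F v

lemma IsLyapunovNorm.mono [Fintype ι] {p : ℝ} {T : ι → Module.End ℂ V} {F : Seminorm ℂ V}
    {c c' : ℝ} (h : IsLyapunovNorm p T F c) (hc : c ≤ c') : IsLyapunovNorm p T F c' :=
  ⟨h.definite, fun q hq hs v => (h.average_le q hq hs v).trans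
    (mul_le_mul_of_nonneg_right hc (apply_nonneg F v))⟩

/-- An irreducible, periodically stable family is nonexpansive for some norm. -/
lemma IsIrreducibleFamily.exists_nonexpansive_seminorm [FiniteDimensional ℂ V] [Nontrivial V]
    {T : ι → Module.End ℂ V} (hT : IsIrreducibleFamily T) (hs : IsWeaklyPeriodicallyStable T) :
    ∃ N : Seminorm ℂ V, (∀ v, N v = 0 → v = 0) ∧ ∀ i v, N (T i v) ≤ N v := by
  obtain ⟨u, hu⟩ := exists_ne (0 : V)
  obtain ⟨φ, hφ⟩ := Module.Projective.exists_dual_ne_zero ℂ hu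
  have hbdd : ∀ v, BddAbove (Set.range fun w => ‖φ (wordProd T w v)‖) := fun v => by
    obtain ⟨C, hC⟩ := hT.exists_norm_apply_wordProd_le hs φ v
    exact ⟨C, by rintro _ ⟨w, rfl⟩; exact hC w⟩
  let N : Seminorm ℂ V := Seminorm.of (fun v => ⨆ w, ‖φ (wordProd T w v)‖)
    (fun v₁ v₂ => ciSup_le fun w => by
      rw [map_add, map_add]
      exact norm_add_le_of_le (le_ciSup (hbdd v₁) w) (le_ciSup (hbdd v₂) w))
    (fun c v => by
      simp only [map_smul, norm_smul]
      exact (Real.mul_iSup_of_nonneg (norm_nonneg c) _).symm)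
  have hN : ∀ v w, ‖φ (wordProd T w v)‖ ≤ N v := fun v w => le_ciSup (hbdd v) w
  have hTN : ∀ i v, N (T i v) ≤ N v := fun i v => ciSup_le fun w => by
    simpa [wordProd_append] using hN v (w ++ [i])
  refine ⟨N, ?_, hTN⟩
  -- The null space of `N` is invariant, and it misses `u` because the empty word gives `N u ≥ ‖φ u‖
  -- > 0`. Irreducibility makes it zero.
  let K : Submodule ℂ V :=
    { carrier := {v | N v = 0}
      add_mem' := fun {a b} ha hb => le_antisymm
        ((map_add_le_add N a b).trans (by rw [ha.out, hb.out, add_zero])) (apply_nonneg N _)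
      zero_mem' := map_zero N
      smul_mem' := fun c v hv => by
        rw [Set.mem_ofPred_eq, map_smul_eq_mul, hv.out, mul_zero] }
  rcases hT K fun i v hv => le_antisymm ((hTN i v).trans_eq hv) (apply_nonneg N _) with h | h
  · intro v hv
    have : v ∈ K := hv
    simpa [h] using this
  · have h1 : u ∈ K := h ▸ Submodule.mem_top
    have h2 := hN u []
    rw [h1.out] at h2
    exact absurd (norm_le_zero_iff.1 h2) hφ

/-- Powers of a weakly stable endomorphism converge to `0` uniformly. -/
lemma Seminorm.eventually_pow_le_half [FiniteDimensional ℂ V] (N : Seminorm ℂ V)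
    (hN : ∀ v, N v = 0 → v = 0) {S : Module.End ℂ V}
    (hS : ∀ (φ : Module.Dual ℂ V) (v : V), Tendsto (fun k : ℕ => φ ((S ^ k) v)) atTop (𝓝 0)) :
    ∀ᶠ k : ℕ in atTop, ∀ v, N ((S ^ k) v) ≤ N v / 2 := by
  let b := Module.finBasis ℂ V
  have hle : ∀ v, N v ≤ ∑ j, ‖b.coord j v‖ * N (b j) := fun v => by
    calc N v = N (∑ i, b.repr v i • b i) := by rw [b.sum_repr]
      _ ≤ ∑ i, N (b.repr v i • b i) :=
        Finset.le_sum_of_subadditive N (map_zero N).le (map_add_le_add N) _ _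
      _ = _ := by simp [map_smul_eq_mul]
  have h0 : ∀ v, Tendsto (fun k : ℕ => N ((S ^ k) v)) atTop (𝓝 0) := fun v => by
    refine squeeze_zero (fun k => apply_nonneg N _) (fun k => hle _) ?_
    have := tendsto_finsetSum (Finset.univ) fun j (_ : j ∈ Finset.univ) =>
      ((hS (b.coord j) v).norm.mul_const (N (b j)))
    simpa using this
  have hcoord : ∀ j, ∃ C : ℝ, 0 ≤ C ∧ ∀ v, ‖b.coord j v‖ ≤ C * N v := fun j =>
    N.exists_le_mul_of_definite ((normSeminorm ℂ ℂ).comp (b.coord j)) hN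
  choose C hC0 hC using hcoord
  have hsum : Tendsto (fun k : ℕ => ∑ j, C j * N ((S ^ k) (b j))) atTop (𝓝 0) := by
    have := tendsto_finsetSum (Finset.univ) fun j (_ : j ∈ Finset.univ) =>
      ((h0 (b j)).const_mul (C j))
    simpa using this
  filter_upwards [hsum.eventually_le_const (show (0 : ℝ) < 1 / 2 by norm_num)] with k hk v
  calc N ((S ^ k) v) = N (∑ j, b.repr v j • (S ^ k) (b j)) := by
        conv_lhs => rw [← b.sum_repr v]
        simp only [map_sum, map_smul]
    _ ≤ ∑ j, N (b.repr v j • (S ^ k) (b j)) :=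
        Finset.le_sum_of_subadditive N (map_zero N).le (map_add_le_add N) _ _
    _ = ∑ j, ‖b.coord j v‖ * N ((S ^ k) (b j)) := by simp [map_smul_eq_mul]
    _ ≤ ∑ j, C j * N v * N ((S ^ k) (b j)) :=
        Finset.sum_le_sum fun j _ => mul_le_mul_of_nonneg_right (hC j v) (apply_nonneg N _)
    _ = (∑ j, C j * N ((S ^ k) (b j))) * N v := by
        rw [Finset.sum_mul]; exact Finset.sum_congr rfl fun _ _ => by ring
    _ ≤ 1 / 2 * N v := mul_le_mul_of_nonneg_right hk (apply_nonneg N v)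
    _ = N v / 2 := by ring

/-- A nonexpansive norm with a contracting power of one letter yields a Lyapunov norm. -/
lemma exists_isLyapunovNorm_of_nonexpansive [Fintype ι] {p : ℝ} (hp : 0 < p)
    {T : ι → Module.End ℂ V} {N : Seminorm ℂ V} (hN : ∀ v, N v = 0 → v = 0)
    (hT : ∀ i v, N (T i v) ≤ N v) (a : ι) {m : ℕ} (hm : m ≠ 0)
    (ha : ∀ v, N ((T a ^ m) v) ≤ N v / 2) :
    ∃ F : Seminorm ℂ V, ∃ c < 1, IsLyapunovNorm p T F c := by
  classical
  -- The weights `p ^ k` make `p * F (T a v)` telescope against `F v`. The remaining mass `1 - p`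
  -- costs at most `(1 - p) * s * N v = (1 - p ^ m) * N v`, so the net gain is at least `p ^ m / 2 *
  -- N v`.
  let F : Seminorm ℂ V := Seminorm.of (fun v => ∑ k ∈ Finset.range m, p ^ k * N ((T a ^ k) v))
    (fun u v => by
      rw [← Finset.sum_add_distrib]
      refine Finset.sum_le_sum fun k _ => ?_
      rw [map_add, ← mul_add]
      exact mul_le_mul_of_nonneg_left (map_add_le_add N _ _) (by positivity))
    (fun c v => by
      rw [Finset.mul_sum]
      refine Finset.sum_congr rfl fun k _ => ?_
      rw [map_smul, map_smul_eq_mul]; ring)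
  have hF : ∀ v, F v = ∑ k ∈ Finset.range m, p ^ k * N ((T a ^ k) v) := fun _ => rfl
  set s : ℝ := ∑ k ∈ Finset.range m, p ^ k with hs
  have hs0 : 0 < s := Finset.sum_pos (fun k _ => by positivity) ⟨0, by simp; omega⟩
  have hpow : ∀ k v, N ((T a ^ k) v) ≤ N v := fun k v => by
    induction k with
    | zero => simp
    | succ k ih => rw [pow_succ', Module.End.mul_apply]; exact (hT a _).trans ih
  have hFN : ∀ v, F v ≤ s * N v := fun v => by
    rw [hF, hs, Finset.sum_mul]
    exact Finset.sum_le_sum fun k _ => mul_le_mul_of_nonneg_left (hpow k v) (by positivity)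
  have hFT : ∀ i v, F (T i v) ≤ s * N v := fun i v =>
    (hFN _).trans (mul_le_mul_of_nonneg_left (hT i v) hs0.le)
  have hgeom : s * (1 - p) = 1 - p ^ m := geom_sum_mul_neg p m
  have htel : ∀ v, p * F (T a v) = F v + p ^ m * N ((T a ^ m) v) - N v := fun v => by
    have h1 : p * F (T a v) = ∑ k ∈ Finset.range m, p ^ (k + 1) * N ((T a ^ (k + 1)) v) := by
      rw [hF, Finset.mul_sum]
      refine Finset.sum_congr rfl fun k _ => ?_
      rw [pow_succ (T a), Module.End.mul_apply]; ring
    have h2 := Finset.sum_range_succ' (fun k => p ^ k * N ((T a ^ k) v)) m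
    rw [Finset.sum_range_succ, ← hF, ← h1] at h2
    simp only [pow_zero, one_mul, Module.End.one_apply] at h2
    linarith
  refine ⟨F, 1 - p ^ m / (2 * s), ?_, ?_, ?_⟩
  · have : 0 < p ^ m / (2 * s) := by positivity
    linarith
  · intro v hv
    refine hN v (le_antisymm ?_ (apply_nonneg N v))
    rw [← hv, hF]
    have := Finset.single_le_sum (f := fun k => p ^ k * N ((T a ^ k) v))
      (fun k _ => by positivity) (Finset.mem_range.2 (Nat.pos_of_ne_zero hm))
    simpa using this
  · intro q hq hsum v
    rw [← Finset.add_sum_erase _ _ (Finset.mem_univ a)] at hsum ⊢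
    have h1 : ∑ i ∈ Finset.univ.erase a, q i * F (T i v) ≤ (1 - q a) * (s * N v) := by
      rw [← eq_sub_of_add_eq' hsum, Finset.sum_mul]
      exact Finset.sum_le_sum fun i _ =>
        mul_le_mul_of_nonneg_left (hFT i v) (hp.le.trans (hq i))
    have h2 : (q a - p) * F (T a v) ≤ (q a - p) * (s * N v) :=
      mul_le_mul_of_nonneg_left (hFT a v) (sub_nonneg.2 (hq a))
    have h3 : p ^ m * N ((T a ^ m) v) ≤ p ^ m * (N v / 2) :=
      mul_le_mul_of_nonneg_left (ha v) (by positivity)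
    have h4 : p ^ m / (2 * s) * F v ≤ p ^ m / 2 * N v := by
      calc p ^ m / (2 * s) * F v ≤ p ^ m / (2 * s) * (s * N v) :=
            mul_le_mul_of_nonneg_left (hFN v) (by positivity)
        _ = _ := by field_simp
    have h5 : s * (1 - p) * N v = (1 - p ^ m) * N v := by rw [hgeom]
    linarith [htel v]

/-- Lyapunov norms on an invariant subspace and on the quotient yield one on the whole space. -/
lemma exists_isLyapunovNorm_of_submodule [Fintype ι] [FiniteDimensional ℂ V] {p : ℝ} (hp : 0 < p)
    {T : ι → Module.End ℂ V} (U : Submodule ℂ V) (hU : ∀ i, U ≤ U.comap (T i))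
    {G : Seminorm ℂ U} {Q : Seminorm ℂ (V ⧸ U)} {c : ℝ} (hc : c < 1)
    (hG : IsLyapunovNorm p (fun i => (T i).restrict (hU i)) G c)
    (hQ : IsLyapunovNorm p (fun i => U.mapQ U (T i) (hU i)) Q c) :
    ∃ F : Seminorm ℂ V, ∃ c < 1, IsLyapunovNorm p T F c := by
  -- A linear section `σ` and the projection `ρ` onto `U` make the `T i` block triangular, with
  -- corner `ρ ∘ T i ∘ σ`.
  obtain ⟨σ, hσ⟩ := U.mkQ.exists_rightInverse_of_surjective U.range_mkQ
  have hσ' : ∀ y, U.mkQ (σ y) = y := fun y => LinearMap.congr_fun hσ y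
  let ρ : V →ₗ[ℂ] U := (LinearMap.id - σ ∘ₗ U.mkQ).codRestrict U fun v => by
    refine (Submodule.Quotient.mk_eq_zero U).1 ?_
    change U.mkQ (v - σ (U.mkQ v)) = 0
    rw [map_sub, hσ', sub_self]
  have hρU : ∀ x : U, ρ x = x := fun x => by
    ext
    have : U.mkQ x = 0 := by simp
    simp [ρ, -Submodule.mkQ_apply, this]
  have hρT : ∀ i v, ρ (T i v) = (T i).restrict (hU i) (ρ v) + ρ (T i (σ (U.mkQ v))) :=
      fun i v => by
    have h1 : T i v = ((T i).restrict (hU i) (ρ v) : U) + T i (σ (U.mkQ v)) := by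
      simp [ρ, -Submodule.mkQ_apply]
    conv_lhs => rw [h1]
    rw [map_add, hρU]
  have hbound : ∀ i, ∃ C : ℝ, 0 ≤ C ∧ ∀ y, G (ρ (T i (σ y))) ≤ C * Q y := fun i =>
    Q.exists_le_mul_of_definite (G.comp (ρ ∘ₗ T i ∘ₗ σ)) hQ.definite
  choose C hC0 hC using hbound
  set D : ℝ := ∑ i, C i with hD
  have hD0 : 0 ≤ D := Finset.sum_nonneg fun i _ => hC0 i
  -- `K` is large enough for the quotient's contraction to absorb the corner terms, of total size
  -- `D`, at the rate `(1 + c) / 2`. The `+ 1` keeps `K` positive when `D = 0`.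
  obtain ⟨K, hK0, hK⟩ : ∃ K : ℝ, 0 < K ∧ D + K * c ≤ (1 + c) / 2 * K := by
    have hc' : 0 < 1 - c := sub_pos.2 hc
    refine ⟨2 * D / (1 - c) + 1, by positivity, ?_⟩
    have : 2 * D / (1 - c) * (1 - c) = 2 * D := by field_simp
    nlinarith
  let F : Seminorm ℂ V := Seminorm.of (fun v => G (ρ v) + K * Q (U.mkQ v))
    (fun u v => by
      have h1 := map_add_le_add G (ρ u) (ρ v)
      have h2 := mul_le_mul_of_nonneg_left (map_add_le_add Q (U.mkQ u) (U.mkQ v)) hK0.le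
      rw [map_add ρ, map_add U.mkQ]
      linarith)
    (fun a v => by
      rw [map_smul ρ, map_smul U.mkQ, map_smul_eq_mul, map_smul_eq_mul]; ring)
  have hF : ∀ v, F v = G (ρ v) + K * Q (U.mkQ v) := fun _ => rfl
  refine ⟨F, (1 + c) / 2, by linarith, fun v hv => ?_, fun q hq hs v => ?_⟩
  · have h1 := apply_nonneg G (ρ v)
    have h2 := apply_nonneg Q (U.mkQ v)
    rw [hF] at hv
    have h3 : U.mkQ v = 0 := hQ.definite _ (by nlinarith)
    have h4 : ρ v = 0 := hG.definite _ (by nlinarith)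
    have h5 : (ρ v : V) = v - σ (U.mkQ v) := rfl
    rw [h3, h4] at h5
    simpa using h5.symm
  · have hq0 : ∀ i, 0 ≤ q i := fun i => hp.le.trans (hq i)
    have hq1 : ∀ i, q i ≤ 1 := fun i =>
      hs ▸ Finset.single_le_sum (fun j _ => hq0 j) (Finset.mem_univ i)
    have hterm : ∀ i, q i * F (T i v) ≤ q i * G ((T i).restrict (hU i) (ρ v)) +
        C i * Q (U.mkQ v) + K * (q i * Q (U.mapQ U (T i) (hU i) (U.mkQ v))) := fun i => by
      have h1 : G (ρ (T i v)) ≤ G ((T i).restrict (hU i) (ρ v)) + C i * Q (U.mkQ v) := by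
        rw [hρT]
        exact (map_add_le_add G _ _).trans (add_le_add_right (hC i _) _)
      have h2 := mul_le_mul_of_nonneg_left h1 (hq0 i)
      have h3 : q i * (C i * Q (U.mkQ v)) ≤ C i * Q (U.mkQ v) :=
        mul_le_of_le_one_left (mul_nonneg (hC0 i) (apply_nonneg Q _)) (hq1 i)
      have h4 : U.mapQ U (T i) (hU i) (U.mkQ v) = U.mkQ (T i v) := rfl
      rw [hF, h4]
      linarith
    have hsum := Finset.sum_le_sum fun i (_ : i ∈ Finset.univ) => hterm i
    rw [Finset.sum_add_distrib, Finset.sum_add_distrib, ← Finset.sum_mul, ← Finset.mul_sum,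
      ← hD] at hsum
    have h1 := hG.average_le q hq hs (ρ v)
    have h2 := mul_le_mul_of_nonneg_left (hQ.average_le q hq hs (U.mkQ v)) hK0.le
    have h3 := mul_le_mul_of_nonneg_right hK (apply_nonneg Q (U.mkQ v))
    have h4 : c * G (ρ v) ≤ (1 + c) / 2 * G (ρ v) :=
      mul_le_mul_of_nonneg_right (by linarith) (apply_nonneg G _)
    rw [hF]
    linarith

/-- A periodically stable family of endomorphisms has a Lyapunov norm. -/
theorem IsWeaklyPeriodicallyStable.exists_isLyapunovNorm [Fintype ι] [FiniteDimensional ℂ V]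
    {p : ℝ} (hp : 0 < p) {T : ι → Module.End ℂ V} (hT : IsWeaklyPeriodicallyStable T) :
    ∃ F : Seminorm ℂ V, ∃ c < 1, IsLyapunovNorm p T F c := by
  induction hn : Module.finrank ℂ V using Nat.strong_induction_on generalizing V with
  | _ n ih =>
  rcases subsingleton_or_nontrivial V with hV | hV
  · exact ⟨0, 0, one_pos, fun v _ => Subsingleton.elim _ _, by simp⟩
  by_cases hirr : IsIrreducibleFamily T
  · obtain ⟨N, hN, hTN⟩ := hirr.exists_nonexpansive_seminorm hT
    rcases isEmpty_or_nonempty ι with hι | ⟨⟨a⟩⟩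
    · exact ⟨N, 0, one_pos, hN, by simp⟩
    · have ha := N.eventually_pow_le_half hN (S := T a)
        (by simpa using hT [a] (List.cons_ne_nil _ _))
      obtain ⟨m, hm, hm0⟩ := (ha.and (eventually_ne_atTop 0)).exists
      exact exists_isLyapunovNorm_of_nonexpansive hp hN hTN a hm0 hm
  · simp only [IsIrreducibleFamily, not_forall, not_or] at hirr
    obtain ⟨U, hU, hbot, htop⟩ := hirr
    have hadd := U.finrank_quotient_add_finrank
    have hpos : 0 < Module.finrank ℂ U :=
      Nat.pos_of_ne_zero fun h => hbot (Submodule.finrank_eq_zero.1 h)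
    have hlt := Submodule.finrank_lt htop
    obtain ⟨G, c₁, hc₁, hG⟩ := ih _ (hn ▸ hlt)
      (hT.of_injective (S := fun i => (T i).restrict (hU i)) U.subtype U.subtype_injective
        fun _ _ => rfl) rfl
    obtain ⟨Q, c₂, hc₂, hQ⟩ := ih _ (by omega)
      (hT.of_surjective (S := fun i => U.mapQ U (T i) (hU i)) U.mkQ U.mkQ_surjective
        fun _ _ => rfl) rfl
    exact exists_isLyapunovNorm_of_submodule hp U hU (max_lt hc₁ hc₂)
      (hG.mono (le_max_left _ _)) (hQ.mono (le_max_right _ _))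

end Lyapunov

/-! ### From periodic sequences to powers of word products -/

section Trajectories

variable {l d : ℕ} (A : Fin l → Matrix (Fin d) (Fin d) ℂ)

lemma cocycle_congr {x y : SymbolSeq l} {n : ℕ} (h : ∀ k < n, x k = y k) :
    cocycle A x n = cocycle A y n := by
  induction n with
  | zero => rfl
  | succ n ih =>
    rw [cocycle, cocycle, h n n.lt_succ_self, ih fun k hk => h k (hk.trans n.lt_succ_self)]

lemma shift_iterate (x : SymbolSeq l) (m n : ℕ) : shift^[m] x n = x (n + m) := by
  induction m generalizing x with
  | zero => rfl
  | succ m ih => rw [Function.iterate_succ_apply, ih]; rfl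

lemma cocycle_add (x : SymbolSeq l) (m n : ℕ) :
    cocycle A x (n + m) = cocycle A (shift^[m] x) n * cocycle A x m := by
  induction n with
  | zero => simp [cocycle]
  | succ n ih => rw [Nat.add_right_comm, cocycle, cocycle, ih, shift_iterate, mul_assoc]

lemma cocycle_mul_of_isPeriodicPt {x : SymbolSeq l} {m : ℕ}
    (hx : Function.IsPeriodicPt shift m x) (k : ℕ) : cocycle A x (k * m) = cocycle A x m ^ k := by
  induction k with
  | zero => simp [cocycle]
  | succ k ih => rw [Nat.succ_mul, cocycle_add, hx.eq, ih, pow_succ]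

/-- The reversal appears because the cocycle puts later letters on the left. -/
lemma mulVecLin_cocycle_eq_wordProd (w : List (Fin l)) (x : SymbolSeq l)
    (hx : ∀ (k : ℕ) (hk : k < w.reverse.length), x k = w.reverse[k]) :
    (cocycle A x w.length).mulVecLin = wordProd (fun i => (A i).mulVecLin) w := by
  induction w with
  | nil => simp [cocycle, Module.End.one_eq_id]
  | cons a w ih =>
    have ha : x w.length = a := by
      rw [hx w.length (by simp)]; simp
    rw [List.length_cons, cocycle, Matrix.mulVecLin_mul, wordProd_cons, ha, ih fun k hk => ?_]
    · rfl
    · rw [hx k (by simp at hk ⊢; omega)]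
      simp only [List.reverse_cons]
      exact List.getElem_append_left hk

lemma IsPeriodicallyAsymptoticallyStable.isWeaklyPeriodicallyStable {A}
    (hA : IsPeriodicallyAsymptoticallyStable (l := l) (d := d) A) :
    IsWeaklyPeriodicallyStable fun i => (A i).mulVecLin := by
  intro w hw φ v
  have hpos : 0 < w.reverse.length := by simpa [List.length_pos_iff] using hw
  let x : SymbolSeq l := fun n => w.reverse[n % w.reverse.length]'(Nat.mod_lt _ hpos)
  have hper : Function.IsPeriodicPt shift w.length x := by
    funext n
    rw [shift_iterate]
    simp [x]
  have hprod := mulVecLin_cocycle_eq_wordProd A w x fun k hk => by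
    simp only [x, Nat.mod_eq_of_lt hk]
  have hlen : 0 < w.length := by simpa using hpos
  have h1 := (hA x (Function.mk_mem_periodicPts hlen hper) v).comp
    (tendsto_atTop_mono (fun k => Nat.le_mul_of_pos_right k hlen) tendsto_id)
  have h2 := (φ.continuous_of_finiteDimensional.tendsto 0).comp h1
  rw [map_zero] at h2
  refine h2.congr fun k => ?_
  have h3 : (cocycle A x w.length ^ k).mulVecLin = wordProd (fun i => (A i).mulVecLin) w ^ k := by
    rw [← hprod]
    exact map_pow (Matrix.toLinAlgEquiv' (R := ℂ) (n := Fin d)) (cocycle A x w.length) k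
  rw [← h3]
  simp [trajectory, cocycle_mul_of_isPeriodicPt A hper]

end Trajectories

/-! ### Geometric decay of expectations and almost sure convergence -/

section Markov

variable {l d : ℕ} {A : Fin l → Matrix (Fin d) (Fin d) ℂ} {μ : Measure (SymbolSeq l)}
  {p : Fin l → ℝ} {P : Matrix (Fin l) (Fin l) ℝ}

/-- The eventually constant sequence that starts with a given word. -/
def wordSeq {n : ℕ} (w : Fin (n + 1) → Fin l) : SymbolSeq l := fun k => w (Fin.ofNat (n + 1) k)

/-- `Fin.ofNat` reduces modulo `n + 1`, so `wordSeq w` repeats `w`; only the first `n + 1` values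
matter below. -/
lemma wordSeq_apply {n : ℕ} (w : Fin (n + 1) → Fin l) (k : Fin (n + 1)) : wordSeq w k = w k := by
  simp [wordSeq]

/-- The mass that the Markov measure of `p` and `P` gives to the cylinder of a word. -/
def wordWeight (p : Fin l → ℝ) (P : Matrix (Fin l) (Fin l) ℝ) {n : ℕ} (w : Fin (n + 1) → Fin l) :
    ℝ :=
  p (w 0) * ∏ k : Fin n, P (w k.castSucc) (w k.succ)

/-- The expected value of `f` on the `n`-th point of the trajectory of `v`. -/
def expectedValue (p : Fin l → ℝ) (P : Matrix (Fin l) (Fin l) ℝ)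
    (A : Fin l → Matrix (Fin d) (Fin d) ℂ) (f : (Fin d → ℂ) → ℝ) (v : Fin d → ℂ) (n : ℕ) : ℝ :=
  ∑ w : Fin (n + 1) → Fin l, wordWeight p P w * f (trajectory A (wordSeq w) v (n + 1))

lemma wordWeight_nonneg (hp : ∀ i, 0 ≤ p i) (hP : ∀ i j, 0 ≤ P i j) {n : ℕ}
    (w : Fin (n + 1) → Fin l) : 0 ≤ wordWeight p P w :=
  mul_nonneg (hp _) (Finset.prod_nonneg fun _ _ => hP _ _)

lemma wordWeight_snoc {n : ℕ} (w : Fin (n + 1) → Fin l) (j : Fin l) :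
    wordWeight p P (Fin.snoc w j : Fin (n + 2) → Fin l) =
      wordWeight p P w * P (w (Fin.last n)) j := by
  have h0 : (Fin.snoc w j : Fin (n + 2) → Fin l) 0 = w 0 := Fin.snoc_apply_zero ..
  have h1 : ∀ k : Fin (n + 1), (Fin.snoc w j : Fin (n + 2) → Fin l) k.castSucc = w k := fun k =>
    Fin.snoc_castSucc ..
  have h2 : (Fin.snoc w j : Fin (n + 2) → Fin l) (Fin.last (n + 1)) = j := Fin.snoc_last ..
  rw [wordWeight, wordWeight, Fin.prod_univ_castSucc, h0, Fin.succ_last, h2, h1, ← mul_assoc]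
  simp only [h1, Fin.succ_castSucc]

lemma trajectory_wordSeq_snoc (v : Fin d → ℂ) {n : ℕ} (w : Fin (n + 1) → Fin l) (j : Fin l) :
    trajectory A (wordSeq (Fin.snoc w j : Fin (n + 2) → Fin l)) v (n + 2) =
      (A j).mulVecLin (trajectory A (wordSeq w) v (n + 1)) := by
  have h1 : wordSeq (Fin.snoc w j : Fin (n + 2) → Fin l) (n + 1) = j := by
    have := wordSeq_apply (Fin.snoc w j : Fin (n + 2) → Fin l) (Fin.last (n + 1))
    rwa [Fin.snoc_last] at this
  have h2 : ∀ k < n + 1, wordSeq (Fin.snoc w j : Fin (n + 2) → Fin l) k = wordSeq w k := by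
    intro k hk
    have h3 := wordSeq_apply (Fin.snoc w j : Fin (n + 2) → Fin l) (Fin.castSucc ⟨k, hk⟩)
    rw [Fin.snoc_castSucc] at h3
    exact h3.trans (wordSeq_apply w ⟨k, hk⟩).symm
  rw [trajectory, cocycle, h1, cocycle_congr A h2, ← Matrix.mulVec_mulVec]
  rfl

lemma expectedValue_nonneg (hp : ∀ i, 0 ≤ p i) (hP : ∀ i j, 0 ≤ P i j) {f : (Fin d → ℂ) → ℝ}
    (hf : ∀ v, 0 ≤ f v) (v : Fin d → ℂ) (n : ℕ) : 0 ≤ expectedValue p P A f v n :=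
  Finset.sum_nonneg fun _ _ => mul_nonneg (wordWeight_nonneg hp hP _) (hf _)

/-- Given the word so far, the next letter is distributed by the row of `P` at the last letter, so
the one-step bound applies word by word. -/
lemma expectedValue_succ_le (hp : ∀ i, 0 ≤ p i) (hP : ∀ i j, 0 ≤ P i j) {f : (Fin d → ℂ) → ℝ}
    {c : ℝ} (hf : ∀ i v, ∑ j, P i j * f ((A j).mulVecLin v) ≤ c * f v) (v : Fin d → ℂ) (n : ℕ) :
    expectedValue p P A f v (n + 1) ≤ c * expectedValue p P A f v n := by
  rw [expectedValue, ← (Fin.snocEquiv fun _ : Fin (n + 2) => Fin l).sum_comp,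
    Fintype.sum_prod_type_right, expectedValue, Finset.mul_sum]
  refine Finset.sum_le_sum fun w _ => ?_
  calc ∑ j, wordWeight p P (Fin.snoc w j : Fin (n + 2) → Fin l) *
          f (trajectory A (wordSeq (Fin.snoc w j : Fin (n + 2) → Fin l)) v (n + 2))
      = wordWeight p P w * ∑ j, P (w (Fin.last n)) j *
          f ((A j).mulVecLin (trajectory A (wordSeq w) v (n + 1))) := by
        rw [Finset.mul_sum]
        refine Finset.sum_congr rfl fun j _ => ?_
        rw [wordWeight_snoc, trajectory_wordSeq_snoc, mul_assoc]
    _ ≤ wordWeight p P w * (c * f (trajectory A (wordSeq w) v (n + 1))) :=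
        mul_le_mul_of_nonneg_left (hf _ _) (wordWeight_nonneg hp hP w)
    _ = _ := by ring

lemma expectedValue_le (hp : ∀ i, 0 ≤ p i) (hP : ∀ i j, 0 ≤ P i j) {f : (Fin d → ℂ) → ℝ}
    {c : ℝ} (hc : 0 ≤ c) (hf : ∀ i v, ∑ j, P i j * f ((A j).mulVecLin v) ≤ c * f v)
    (v : Fin d → ℂ) (n : ℕ) : expectedValue p P A f v n ≤ c ^ n * expectedValue p P A f v 0 := by
  induction n with
  | zero => simp
  | succ n ih =>
    rw [pow_succ', mul_assoc]
    exact (expectedValue_succ_le hp hP hf v n).trans (mul_le_mul_of_nonneg_left ih hc)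

lemma trajectory_eq_trajectory_wordSeq (x : SymbolSeq l) (v : Fin d → ℂ) (n : ℕ) :
    trajectory A x v (n + 1) =
      trajectory A (wordSeq fun k : Fin (n + 1) => x k) v (n + 1) := by
  rw [trajectory, cocycle_congr A fun k hk =>
    (wordSeq_apply (fun k : Fin (n + 1) => x k) ⟨k, hk⟩).symm]
  rfl

/-- The function factors through finitely many coordinates, hence through a finite type, so `f`
itself can be arbitrary. -/
lemma measurable_trajectory_succ (f : (Fin d → ℂ) → ℝ) (v : Fin d → ℂ) (n : ℕ) :
    Measurable fun x : SymbolSeq l => ENNReal.ofReal (f (trajectory A x v (n + 1))) := by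
  have hr : Measurable fun (x : SymbolSeq l) (k : Fin (n + 1)) => x k := by fun_prop
  have heq : (fun x : SymbolSeq l => ENNReal.ofReal (f (trajectory A x v (n + 1)))) = _ :=
    funext fun x => congrArg (fun u => ENNReal.ofReal (f u))
      (trajectory_eq_trajectory_wordSeq x v n)
  rw [heq]
  exact (measurable_of_finite fun w : Fin (n + 1) → Fin l =>
    ENNReal.ofReal (f (trajectory A (wordSeq w) v (n + 1)))).comp hr

lemma IsMarkovMeasureWith.lintegral_trajectory (h : IsMarkovMeasureWith μ p P)
    {f : (Fin d → ℂ) → ℝ} (hf : ∀ v, 0 ≤ f v) (v : Fin d → ℂ) (n : ℕ) :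
    ∫⁻ x, ENNReal.ofReal (f (trajectory A x v (n + 1))) ∂μ =
      ENNReal.ofReal (expectedValue p P A f v n) := by
  have hp : ∀ i, 0 ≤ p i := h.initial_mem.1
  have hP : ∀ i j, 0 ≤ P i j := fun i j =>
    ((Matrix.mem_rowStochastic_iff_sum).1 h.transition_mem).1 i j
  have hr : Measurable fun (x : SymbolSeq l) (k : Fin (n + 1)) => x k := by fun_prop
  have heq : (fun x : SymbolSeq l => ENNReal.ofReal (f (trajectory A x v (n + 1)))) = _ :=
    funext fun x => congrArg (fun u => ENNReal.ofReal (f u))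
      (trajectory_eq_trajectory_wordSeq x v n)
  rw [heq]
  rw [← lintegral_map (f := fun w : Fin (n + 1) → Fin l =>
    ENNReal.ofReal (f (trajectory A (wordSeq w) v (n + 1)))) (measurable_of_finite _) hr,
    lintegral_fintype, expectedValue, ENNReal.ofReal_sum_of_nonneg fun w _ =>
      mul_nonneg (wordWeight_nonneg hp hP w) (hf _)]
  refine Finset.sum_congr rfl fun w _ => ?_
  have hset : (fun (x : SymbolSeq l) (k : Fin (n + 1)) => x k) ⁻¹' {w} =
      {x | ∀ k : Fin (n + 1), x k = w k} := by
    ext x; exact funext_iff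
  rw [Measure.map_apply hr (measurableSet_singleton w), hset, h.cylinder,
    ENNReal.ofReal_mul (wordWeight_nonneg hp hP w), mul_comm]
  rfl

/-- The sum over `n` of `f` along the trajectory has finite integral, so it is finite almost
everywhere and its terms tend to `0`. -/
lemma IsMarkovMeasureWith.ae_tendsto_zero (h : IsMarkovMeasureWith μ p P)
    {f : (Fin d → ℂ) → ℝ} (hf : ∀ v, 0 ≤ f v) {c : ℝ} (hc : 0 ≤ c) (hc1 : c < 1)
    (hfc : ∀ i v, ∑ j, P i j * f ((A j).mulVecLin v) ≤ c * f v) (v : Fin d → ℂ) :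
    ∀ᵐ x ∂μ, Tendsto (fun n => f (trajectory A x v n)) atTop (𝓝 0) := by
  have hp : ∀ i, 0 ≤ p i := h.initial_mem.1
  have hP : ∀ i j, 0 ≤ P i j := fun i j =>
    ((Matrix.mem_rowStochastic_iff_sum).1 h.transition_mem).1 i j
  have hsum : Summable (expectedValue p P A f v) :=
    Summable.of_nonneg_of_le (expectedValue_nonneg hp hP hf v)
      (expectedValue_le hp hP hc hfc v) ((summable_geometric_of_lt_one hc hc1).mul_right _)
  have hfin : ∫⁻ x, ∑' n, ENNReal.ofReal (f (trajectory A x v (n + 1))) ∂μ ≠ ⊤ := by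
    rw [lintegral_tsum fun n => (measurable_trajectory_succ f v n).aemeasurable]
    simp_rw [h.lintegral_trajectory hf]
    exact hsum.tsum_ofReal_ne_top
  filter_upwards [ae_lt_top (Measurable.tsum (measurable_trajectory_succ f v)) hfin]
    with x hx
  have h1 := (ENNReal.tendsto_toReal ENNReal.zero_ne_top).comp
    (ENNReal.tendsto_atTop_zero_of_tsum_ne_top hx.ne)
  refine (tendsto_add_atTop_iff_nat 1).1 ?_
  refine h1.congr fun n => ?_
  simp [ENNReal.toReal_ofReal (hf _)]

end Markov

theorem mainTheorem5 (l d : ℕ) (A : Fin l → Matrix (Fin d) (Fin d) ℂ)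
    (hA : IsPeriodicallyAsymptoticallyStable A) :
    IsMarkovAsymptoticallyStable A := by
  rintro μ ⟨p, P, h, hne⟩
  rcases isEmpty_or_nonempty (Fin l) with hl | hl
  · exact Eventually.of_forall fun x => hl.elim (x 0)
  have hP := Matrix.mem_rowStochastic_iff_sum.1 h.transition_mem
  obtain ⟨⟨i₀, j₀⟩, hmin⟩ := Finite.exists_min fun ij : Fin l × Fin l => P ij.1 ij.2
  obtain ⟨F, c, hc, hF⟩ := hA.isWeaklyPeriodicallyStable.exists_isLyapunovNorm
    ((hP.1 i₀ j₀).lt_of_ne (hne i₀ j₀).symm)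
  -- The exceptional null set depends on the initial vector; finitely many basis vectors give one
  -- that serves all `v₀`. The rate is `max c 0` since `c` may be negative.
  have hbasis : ∀ᵐ x ∂μ, ∀ i : Fin d, Tendsto
      (fun n => F (trajectory A x (Pi.single i 1) n)) atTop (𝓝 0) :=
    ae_all_iff.2 fun i => h.ae_tendsto_zero (fun v => apply_nonneg F v) (le_max_right c 0)
      (max_lt hc one_pos)
      (fun i => (hF.mono (le_max_left c 0)).average_le (P i) (fun j => hmin (i, j)) (hP.2 i)) _
  obtain ⟨C, -, hC⟩ := F.exists_le_mul_of_definite (normSeminorm ℂ (Fin d → ℂ)) hF.definite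
  filter_upwards [hbasis] with x hx v
  have h1 : ∀ i, Tendsto (trajectory A x (Pi.single i 1)) atTop (𝓝 0) := fun i =>
    squeeze_zero_norm (fun n => hC _) (by simpa using (hx i).const_mul C)
  have h2 := tendsto_finsetSum Finset.univ fun i (_ : i ∈ Finset.univ) => (h1 i).const_smul (v i)
  simp only [smul_zero, Finset.sum_const_zero] at h2
  refine h2.congr fun n => ?_
  conv_rhs => rw [pi_eq_sum_univ' v]
  simp only [trajectory, Matrix.mulVec_sum, Matrix.mulVec_smul]
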